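/- Let $m\ge 2$ be an integer and let $P_{-4,k}(x)$, $k\ge -4$, be the polynomials in $x$ (the variable that parametrizes the curves $u^m=1-2xt^2+t^4$) defined by $P_{-4,-4}=1$, $P_{-4,-3}=P_{-4,-2}=P_{-4,-1}=0$ and $$(km+m+4)\,P_{-4,k}(x)=2x\,((k-1)m+2)\,P_{-4,k-2}(x)-(k-3)m\,P_{-4,k-4}(x),\qquad k\ge 0.$$ For complex numbers $\nu,c$ with $c\notin\{-1,-2,\dots\}$ let $C_n^{(\nu)}(x;c)$ be the associated ultraspherical polynomials, defined by $C_{-1}^{(\nu)}(x;c)=0$, $C_0^{(\nu)}(x;c)=1$ and $$2x(n+\nu+c)\,C_n^{(\nu)}(x;c)=(n+c+1)\,C_{n+1}^{(\nu)}(x;c)+(2\nu+n+c-1)\,C_{n-1}^{(\nu)}(x;c),\qquad n\ge 0.$$ Then $P_{-4,k}=0$ for all odd $k$. Put $q_s=P_{-4,2s}$ for $s\ge -1$, and $c=\tfrac12+\tfrac2m$, $\nu=-\tfrac1m$. Then: 1. $2x(n+\nu+c)\,q_n=(n+c+1)\,q_{n+1}+(2\nu+n+c-1)\,q_{n-1}$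 for all $n\ge 0$, and $q_s(x)=\frac{3m}{m+4}\,C_s^{(\nu)}(x;c)$ for all $s\ge -1$. 2. $(q_s)_{s\ge 0}$ is a sequence of orthogonal polynomials: $\deg q_s=s$, and there is a positive Borel measure $\mu$ on $\mathbb{R}$ for which all products $q_i\overline{q_j}$ are integrable, $\int q_i\overline{q_j}\,d\mu=0$ for $i\ne j$, and $\int |q_i|^2\,d\mu>0$ for all $i\geq 0$. 3. The sequence $(q_s)_{s\ge 0}$ is non-classical: there are no polynomials $\sigma\neq 0$ and $\tau$ with $\deg\sigma\le 2$, $\deg\tau\le 1$, and complex numbers $\lambda_s$, such that $\sigma q_s''+\tau q_s'=\lambda_s q_s$ for all $s\ge 0$. -/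

import Mathlib

open Polynomial MeasureTheory

noncomputable section

/-- The polynomials `P_{-4,k}` with index shifted by four: `superellipticAux m j = P_{-4,j-4}`. -/
def superellipticAux (m : ℕ) : ℕ → ℂ[X]
  | 0 => 1
  | 1 => 0
  | 2 => 0
  | 3 => 0
  | k + 4 =>
      C (((k : ℂ) * m + m + 4)⁻¹) *
        (C (2 * (((k : ℂ) - 1) * m + 2)) * X * superellipticAux m (k + 2)
          - C (((k : ℂ) - 3) * m) * superellipticAux m k)

/-- The polynomial `P_{-4,k}` in the variable `c` (here `X`), for an integer `k ≥ -4`: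
the values at `k = -4, -3, -2, -1` are `1, 0, 0, 0`, and
`(k m + m + 4) P_k = 2 c ((k - 1) m + 2) P_{k-2} - (k - 3) m P_{k-4}` for `k ≥ 0`.
(The values at `k < -4` are never used.) -/
def superellipticP (m : ℕ) (k : ℤ) : ℂ[X] := superellipticAux m (k + 4).toNat

theorem superellipticP_init (m : ℕ) :
    superellipticP m (-4) = 1 ∧ superellipticP m (-3) = 0 ∧
      superellipticP m (-2) = 0 ∧ superellipticP m (-1) = 0 := by
  refine ⟨?_, ?_, ?_, ?_⟩ <;> simp [superellipticP, superellipticAux]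

theorem superellipticP_rec (m : ℕ) (k : ℤ) (hk : 0 ≤ k) :
    C ((k : ℂ) * m + m + 4) * superellipticP m k =
      C (2 * (((k : ℂ) - 1) * m + 2)) * X * superellipticP m (k - 2)
        - C (((k : ℂ) - 3) * m) * superellipticP m (k - 4) := by
  lift k to ℕ using hk
  have h0 : ((k : ℂ) * m + m + 4) ≠ 0 := by
    have h : ((k * m + m + 4 : ℕ) : ℂ) ≠ 0 := Nat.cast_ne_zero.mpr (by omega)
    push_cast at h
    exact h
  have e1 : ((k : ℤ) + 4).toNat = k + 4 := by omega
  have e2 : ((k : ℤ) - 2 + 4).toNat = k + 2 := by omega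
  have e3 : ((k : ℤ) - 4 + 4).toNat = k := by omega
  simp only [superellipticP, e1, e2, e3, Int.cast_natCast]
  rw [superellipticAux, ← mul_assoc, ← C_mul, mul_inv_cancel₀ h0, C_1, one_mul]

/-- The associated ultraspherical polynomials with index shifted by one. -/
def assocUltrasphericalAux (ν c : ℂ) : ℕ → ℂ[X]
  | 0 => 0
  | 1 => 1
  | n + 2 =>
      C (((n : ℂ) + c + 1)⁻¹) *
        (C (2 * ((n : ℂ) + ν + c)) * X * assocUltrasphericalAux ν c (n + 1)
          - C (2 * ν + n + c - 1) * assocUltrasphericalAux ν c n)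

/-- The associated ultraspherical polynomial `C_n^{(ν)}(x; c)` for an integer `n ≥ -1`, where `c`
is not a negative integer: `C_{-1} = 0`, `C_0 = 1`, and
`2 x (n + ν + c) C_n = (n + c + 1) C_{n+1} + (2 ν + n + c - 1) C_{n-1}` for `n ≥ 0`. -/
def assocUltraspherical (ν c : ℂ) (n : ℤ) : ℂ[X] := assocUltrasphericalAux ν c (n + 1).toNat

/-- The sequence `q` satisfies the three-term recurrence of the associated ultraspherical
polynomials with parameters `ν` and `c`. -/
def SatisfiesUltrasphericalRec (ν c : ℂ) (q : ℤ → ℂ[X]) : Prop :=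
  ∀ n : ℤ, 0 ≤ n →
    C (2 * ((n : ℂ) + ν + c)) * X * q n =
      C ((n : ℂ) + c + 1) * q (n + 1) + C (2 * ν + n + c - 1) * q (n - 1)

theorem assocUltraspherical_init (ν c : ℂ) :
    assocUltraspherical ν c (-1) = 0 ∧ assocUltraspherical ν c 0 = 1 := by
  constructor <;> simp [assocUltraspherical, assocUltrasphericalAux]

theorem assocUltraspherical_rec (ν c : ℂ) (hc : ∀ n : ℕ, (n : ℂ) + c + 1 ≠ 0) :
    SatisfiesUltrasphericalRec ν c (assocUltraspherical ν c) := by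
  intro n hn
  lift n to ℕ using hn
  have e1 : ((n : ℤ) + 1 + 1).toNat = n + 2 := by omega
  have e2 : ((n : ℤ) + 1).toNat = n + 1 := by omega
  have e3 : ((n : ℤ) - 1 + 1).toNat = n := by omega
  simp only [assocUltraspherical, e1, e2, e3, Int.cast_natCast]
  rw [assocUltrasphericalAux, ← mul_assoc (C ((n : ℂ) + c + 1)), ← C_mul,
    mul_inv_cancel₀ (hc n), C_1, one_mul]
  ring

/-- `q` is a sequence of orthogonal polynomials with respect to the positive Borel measure `μ` on
the real line: `q n` has degree exactly `n`, all products are integrable, distinct members are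
orthogonal, and every member has positive norm. -/
def IsOrthogonalPolynomialSeq (μ : Measure ℝ) (q : ℕ → ℂ[X]) : Prop :=
  (∀ n, (q n).degree = n) ∧
  (∀ i j, Integrable (fun x : ℝ => (q i).eval (x : ℂ) * star ((q j).eval (x : ℂ))) μ) ∧
  (∀ i j, i ≠ j → ∫ x : ℝ, (q i).eval (x : ℂ) * star ((q j).eval (x : ℂ)) ∂μ = 0) ∧
  (∀ i, 0 < ∫ x : ℝ, ‖(q i).eval (x : ℂ)‖ ^ 2 ∂μ)

/-- An orthogonal polynomial sequence is classical if all its members are eigenfunctions of one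
second-order linear differential operator `σ y'' + τ y'` with polynomial coefficients
(`deg σ ≤ 2`, `deg τ ≤ 1`). By Bochner's theorem these are, up to normalization and affine change
of variable, the Jacobi, Laguerre, Hermite and Bessel polynomials. -/
def IsClassicalSeq (q : ℕ → ℂ[X]) : Prop :=
  ∃ (σ τ : ℂ[X]) (ev : ℕ → ℂ), σ ≠ 0 ∧ σ.degree ≤ 2 ∧ τ.degree ≤ 1 ∧
    ∀ n, σ * derivative (derivative (q n)) + τ * derivative (q n) = C (ev n) * q n

end

/-! The even-index recurrence is the ultraspherical one after division by `2 * m`, so an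
initial-value comparison identifies `q_s`. With `w = 2/m`, its monic form is `p_{n+2} = x p_{n+1} -
γ_n p_n`, where `γ_n` is `superellipticGamma w n`. The only negative coefficient multiplies `q_{-1}
= 0`, so every `γ_n` is positive, and `γ_n ≤ 1`.

Orthogonality is Favard's theorem for bounded coefficients: the Jacobi matrix with off-diagonal
entries `√γ_n` is a bounded self-adjoint operator `T` on `ℓ²`, and its spectral measure at `e_0`
works because `p_n(T) e_0` is a multiple of `e_n` (`exists_measure_orthogonal_monicJacobi`).

For non-classicality, the differential equation for `p_1, ..., p_4` already forces an algebraic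
relation between `γ_0, γ_1, γ_2` unless `σ = 0` (`not_isClassicalSeq_monicJacobi`);
`superellipticGamma_lt` shows that this relation fails. -/

/-! ### Spectral measures and bounded Jacobi operators. -/

open scoped InnerProductSpace in
/-- The distribution of a bounded self-adjoint operator in a vector state. -/
theorem IsSelfAdjoint.exists_measure_integral_eval {H : Type*} [NormedAddCommGroup H]
    [InnerProductSpace ℂ H] [CompleteSpace H] {T : H →L[ℂ] H} (hT : IsSelfAdjoint T) (v : H) :
    ∃ μ : Measure ℝ, ∀ p : ℝ[X], Integrable (fun x => p.eval x) μ ∧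
      ∫ x, p.eval x ∂μ = (⟪v, aeval T p v⟫_ℂ).re := by
  have : CompactSpace (spectrum ℝ T) :=
    isCompact_iff_compactSpace.mp (ContinuousFunctionalCalculus.isCompact_spectrum T)
  -- The functional `f ↦ Re ⟪v, f(T) v⟫` is positive, since `f ≥ 0` gives `f(T) ≥ 0`. Riesz–Markov
  -- represents it by a measure on the spectrum, which is then pushed forward to `ℝ`.
  let Λ : CompactlySupportedContinuousMap (spectrum ℝ T) ℝ →ₚ[ℝ] ℝ := PositiveLinearMap.mk₀
    { toFun := fun f => (⟪v, cfcHom hT (R := ℝ) f.toContinuousMap v⟫_ℂ).re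
      map_add' := fun f g => by
        have : (f + g).toContinuousMap = f.toContinuousMap + g.toContinuousMap := rfl
        simp [this]
      map_smul' := fun c f => by
        have : (c • f).toContinuousMap = c • f.toContinuousMap := rfl
        rw [this, map_smul, smul_apply, ← Complex.coe_smul, inner_smul_right]
        simp } (by
      intro f hf
      have h0 : 0 ≤ cfcHom hT (R := ℝ) f.toContinuousMap :=
        (cfcHom_nonneg_iff hT).2 fun x => hf x
      have h1 := ((ContinuousLinearMap.nonneg_iff_isPositive _).1 h0).re_inner_nonneg_right v
      exact h1)
  refine ⟨(RealRMK.rieszMeasure Λ).map Subtype.val, fun p => ?_⟩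
  have hme : MeasurableEmbedding (Subtype.val : spectrum ℝ T → ℝ) :=
    .subtype_coe (spectrum.isClosed T).measurableSet
  let f : C(spectrum ℝ T, ℝ) := ⟨fun x => p.eval (x : ℝ), by fun_prop⟩
  have hf := RealRMK.integral_rieszMeasure Λ
    (CompactlySupportedContinuousMap.continuousMapEquiv f)
  constructor
  · rw [hme.integrable_map_iff]
    exact (CompactlySupportedContinuousMap.continuousMapEquiv f).integrable
  · rw [hme.integral_map]
    refine hf.trans ?_
    change (⟪v, cfcHom hT (R := ℝ) f v⟫_ℂ).re = _
    rw [← cfc_polynomial p T hT, cfc_apply (R := ℝ) _ T hT p.continuousOn]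
    rfl

/-- The weighted unilateral shift `e n ↦ a n • e (n + 1)` on `ℓ²`. -/
theorem exists_weightedShift (a : ℕ → ℝ) {M : ℝ} (ha : ∀ n, |a n| ≤ M) :
    ∃ V : lp (fun _ : ℕ => ℂ) 2 →L[ℂ] lp (fun _ : ℕ => ℂ) 2,
      ∀ f, V f 0 = 0 ∧ ∀ n, V f (n + 1) = a n * f n := by
  have hM : 0 ≤ M := (abs_nonneg _).trans (ha 0)
  let s (f : ℕ → ℂ) : ℕ → ℂ := fun n => Nat.casesOn n 0 fun n => a n * f n
  have hs (f : lp (fun _ : ℕ => ℂ) 2) (n : ℕ) : ‖s f (n + 1)‖ ^ 2 ≤ M ^ 2 * ‖f n‖ ^ 2 := by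
    have : s f (n + 1) = a n * f n := rfl
    rw [this, norm_mul, mul_pow, Complex.norm_real]
    gcongr
    exact ha n
  have hf (f : lp (fun _ : ℕ => ℂ) 2) : HasSum (fun n => ‖f n‖ ^ 2) (‖f‖ ^ 2) := by
    simpa using lp.hasSum_norm (p := 2) (by norm_num) f
  have hsum (f : lp (fun _ : ℕ => ℂ) 2) : Summable fun n => ‖s f (n + 1)‖ ^ 2 :=
    Summable.of_nonneg_of_le (fun _ => by positivity) (hs f) ((hf f).summable.mul_left _)
  have hmem (f : lp (fun _ : ℕ => ℂ) 2) : Memℓp (s f) 2 := by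
    refine memℓp_gen ?_
    simpa using (summable_nat_add_iff (f := fun n => ‖s f n‖ ^ 2) 1).1 (hsum f)
  let V : lp (fun _ : ℕ => ℂ) 2 →ₗ[ℂ] lp (fun _ : ℕ => ℂ) 2 :=
    { toFun := fun f => ⟨s f, hmem f⟩
      map_add' := fun f g => by
        refine Subtype.ext (funext fun n => ?_)
        cases n with
        | zero => exact (add_zero (0 : ℂ)).symm
        | succ n => exact mul_add (a n : ℂ) (f n) (g n)
      map_smul' := fun c f => by
        refine Subtype.ext (funext fun n => ?_)
        cases n with
        | zero => exact (mul_zero c).symm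
        | succ n => exact mul_left_comm (a n : ℂ) c (f n) }
  refine ⟨V.mkContinuous M fun f => ?_, fun f => ⟨rfl, fun n => rfl⟩⟩
  refine abs_le_of_sq_le_sq' ?_ (by positivity) |>.2
  have h1 : HasSum (fun n => ‖s f n‖ ^ 2) (‖V f‖ ^ 2) := by
    simpa [V] using lp.hasSum_norm (p := 2) (by norm_num) (V f)
  have h2 : HasSum (fun n => ‖s f (n + 1)‖ ^ 2) (‖V f‖ ^ 2) := by
    have := (hasSum_nat_add_iff' 1).2 h1
    simpa [s] using this
  rw [mul_pow]
  exact hasSum_le (hs f) h2 ((hf f).mul_left _)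

/-- Bounded Jacobi operators on `ℓ²`. -/
theorem exists_jacobiOperator (a : ℕ → ℝ) {M : ℝ} (ha : ∀ n, |a n| ≤ M) :
    ∃ T : lp (fun _ : ℕ => ℂ) 2 →L[ℂ] lp (fun _ : ℕ => ℂ) 2, IsSelfAdjoint T ∧
      T (lp.single 2 0 1) = (a 0 : ℂ) • lp.single 2 1 1 ∧
      ∀ n, T (lp.single 2 (n + 1) 1) =
        (a (n + 1) : ℂ) • lp.single 2 (n + 2) 1 + (a n : ℂ) • lp.single 2 n 1 := by
  obtain ⟨V, hV⟩ := exists_weightedShift a ha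
  have hV1 (n : ℕ) : V (lp.single 2 n 1) = (a n : ℂ) • lp.single 2 (n + 1) 1 := by
    generalize hb : (a n : ℂ) = b
    ext k
    cases k with
    | zero => simp [(hV _).1]
    | succ k =>
      by_cases h : k = n
      · subst h
        simp [(hV _).2, hb]
      · simp [(hV _).2, h]
  have hadj (n k : ℕ) : V.adjoint (lp.single 2 n 1) k =
      inner ℂ (V (lp.single 2 k 1)) (lp.single 2 n 1) := by
    rw [← ContinuousLinearMap.adjoint_inner_right, lp.inner_single_left]
    simp
  -- The shift supplies the entries below the diagonal and its adjoint those above.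
  refine ⟨V + V.adjoint, ?_, ?_, fun n => ?_⟩
  · exact IsSelfAdjoint.add_star_self V
  · rw [add_apply, hV1, add_eq_left]
    ext k
    rw [hadj, lp.inner_single_right]
    simp [(hV _).1]
  · rw [add_apply, hV1, add_right_inj]
    have hb : (starRingEnd ℂ) (a n : ℂ) = a n := Complex.conj_ofReal _
    generalize hb' : (a n : ℂ) = b at hb ⊢
    ext k
    rw [hadj, lp.inner_single_right, (hV _).2]
    by_cases h : k = n
    · subst h
      simp [hb', hb]
    · simp [h, Ne.symm h]

/-! ### Monic three-term recurrences and Favard's theorem. -/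

/-- The monic polynomials with `p (n + 2) = X * p (n + 1) - γ n * p n`, `p 0 = 1`, `p 1 = X`. -/
noncomputable def monicJacobi {R : Type*} [CommRing R] (γ : ℕ → R) : ℕ → R[X]
  | 0 => 1
  | 1 => X
  | n + 2 => X * monicJacobi γ (n + 1) - C (γ n) * monicJacobi γ n

theorem monicJacobi_map {R S : Type*} [CommRing R] [CommRing S] (φ : R →+* S) (γ : ℕ → R)
    (n : ℕ) : (monicJacobi γ n).map φ = monicJacobi (fun k => φ (γ k)) n := by
  induction n using Nat.twoStepInduction with
  | zero => simp [monicJacobi]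
  | one => simp [monicJacobi]
  | more n h0 h1 => simp [monicJacobi, h0, h1]

theorem degree_monicJacobi {R : Type*} [CommRing R] [IsDomain R] (γ : ℕ → R) (n : ℕ) :
    (monicJacobi γ n).degree = n := by
  induction n using Nat.twoStepInduction with
  | zero => simp [monicJacobi]
  | one => simp [monicJacobi]
  | more n h0 h1 =>
    have h : (X * monicJacobi γ (n + 1)).degree = ((n + 2 : ℕ) : WithBot ℕ) := by
      rw [degree_mul, degree_X, h1]
      norm_cast
      ring
    rw [monicJacobi, degree_sub_eq_left_of_degree_lt, h]
    rw [h, ← smul_eq_C_mul]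
    refine (degree_smul_le _ _).trans_lt ?_
    rw [h0]
    exact_mod_cast (by omega : n < n + 2)

open scoped InnerProductSpace in
theorem IsSelfAdjoint.exists_measure_orthogonal_monicJacobi {H : Type*} [NormedAddCommGroup H]
    [InnerProductSpace ℂ H] [CompleteSpace H] {T : H →L[ℂ] H} (hT : IsSelfAdjoint T) {e : ℕ → H}
    (he : Orthonormal ℂ e) {γ : ℕ → ℝ} (hγ : ∀ n, 0 < γ n)
    (hT0 : T (e 0) = (√(γ 0) : ℂ) • e 1)
    (hT1 : ∀ n, T (e (n + 1)) = (√(γ (n + 1)) : ℂ) • e (n + 2) + (√(γ n) : ℂ) • e n) :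
    ∃ μ : Measure ℝ, ∀ i j,
      Integrable (fun x => (monicJacobi γ i).eval x * (monicJacobi γ j).eval x) μ ∧
      ∫ x, (monicJacobi γ i).eval x * (monicJacobi γ j).eval x ∂μ =
        if i = j then ∏ k ∈ Finset.range i, γ k else 0 := by
  -- The vector `e 0` is cyclic: the recurrence of the polynomials mirrors the action of `T`. As
  -- `p_i(T)` is self-adjoint, the integral of `p_i p_j` becomes `⟪p_i(T) e_0, p_j(T) e_0⟫`, and
  -- orthonormality of `e` finishes.
  have hp (n : ℕ) : aeval T (monicJacobi γ n) (e 0) =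
      ((∏ k ∈ Finset.range n, √(γ k) : ℝ) : ℂ) • e n := by
    induction n using Nat.twoStepInduction with
    | zero => simp [monicJacobi]
    | one => simpa [monicJacobi] using hT0
    | more n h0 h1 =>
      have hs : ((√(γ n) : ℝ) : ℂ) * (√(γ n) : ℝ) = (γ n : ℝ) := by
        rw [← Complex.ofReal_mul, Real.mul_self_sqrt (hγ n).le]
      have h3 : aeval T (C (γ n) * monicJacobi γ n) (e 0) =
          (γ n : ℂ) • aeval T (monicJacobi γ n) (e 0) := by
        rw [← smul_eq_C_mul, map_smul, smul_apply, Complex.coe_smul]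
      rw [monicJacobi, map_sub, sub_apply, h3, map_mul, aeval_X,
        mul_apply_eq_comp, h0, h1, map_smul, hT1, ← hs]
      simp only [Finset.prod_range_succ, Complex.ofReal_mul]
      module
  obtain ⟨μ, hμ⟩ := hT.exists_measure_integral_eval (e 0)
  refine ⟨μ, fun i j => ?_⟩
  obtain ⟨h1, h2⟩ := hμ (monicJacobi γ i * monicJacobi γ j)
  simp only [eval_mul] at h1 h2
  refine ⟨h1, h2.trans ?_⟩
  have hsa : IsSelfAdjoint (aeval T (monicJacobi γ i)) := by
    rw [← cfc_polynomial _ T hT]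
    exact cfc_predicate _ T
  rw [map_mul, mul_apply_eq_comp, ← ContinuousLinearMap.adjoint_inner_left,
    hsa.adjoint_eq, hp, hp, inner_smul_left, inner_smul_right, Complex.conj_ofReal,
    orthonormal_iff_ite.1 he]
  by_cases hij : i = j
  · subst hij
    have : ∏ k ∈ Finset.range i, γ k =
        (∏ k ∈ Finset.range i, √(γ k)) * ∏ k ∈ Finset.range i, √(γ k) := by
      rw [← Finset.prod_mul_distrib]
      exact Finset.prod_congr rfl fun k _ => (Real.mul_self_sqrt (hγ k).le).symm
    rw [if_pos rfl, if_pos rfl, mul_one, ← Complex.ofReal_mul, Complex.ofReal_re, this]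
  · simp [hij]

/-- Favard's theorem for bounded recurrence coefficients. -/
theorem exists_measure_orthogonal_monicJacobi (γ : ℕ → ℝ) {M : ℝ} (hγ : ∀ n, 0 < γ n)
    (hM : ∀ n, γ n ≤ M) :
    ∃ μ : Measure ℝ, ∀ i j,
      Integrable (fun x => (monicJacobi γ i).eval x * (monicJacobi γ j).eval x) μ ∧
      ∫ x, (monicJacobi γ i).eval x * (monicJacobi γ j).eval x ∂μ =
        if i = j then ∏ k ∈ Finset.range i, γ k else 0 := by
  obtain ⟨T, hT, hT0, hT1⟩ := exists_jacobiOperator (fun n => √(γ n)) (M := √M) fun n => by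
    rw [abs_of_nonneg (Real.sqrt_nonneg _)]
    exact Real.sqrt_le_sqrt (hM n)
  refine hT.exists_measure_orthogonal_monicJacobi (e := fun n => lp.single 2 n 1)
    (orthonormal_iff_ite.2 fun i j => ?_) hγ hT0 hT1
  rw [lp.inner_single_left]
  by_cases h : i = j
  · subst h
    simp
  · simp [h]

/-- Normalizing leading coefficients leaves only the products `α n * β n` in the recurrence; each
step divides the leading coefficient by `α n`. -/
theorem eq_C_mul_monicJacobi {F : Type*} [Field F] {α β : ℕ → F} {q : ℕ → F[X]} {κ : F}
    (hα : ∀ n, α n ≠ 0) (h0 : q 0 = C κ) (h1 : X * q 0 = C (α 0) * q 1)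
    (h : ∀ n, X * q (n + 1) = C (α (n + 1)) * q (n + 2) + C (β n) * q n) (n : ℕ) :
    q n = C (κ / ∏ i ∈ Finset.range n, α i) * monicJacobi (fun i => α i * β i) n := by
  induction n using Nat.twoStepInduction with
  | zero => simp [monicJacobi, h0]
  | one =>
    refine mul_left_cancel₀ (C_ne_zero.2 (hα 0)) ?_
    rw [← h1, h0, ← mul_assoc, ← C_mul, Finset.prod_range_one, mul_div_cancel₀ _ (hα 0), mul_comm]
    rfl
  | more n ih0 ih1 =>
    refine mul_left_cancel₀ (C_ne_zero.2 (hα (n + 1))) ?_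
    rw [eq_sub_of_add_eq (h n).symm, ih0, ih1, monicJacobi]
    simp only [Finset.prod_range_succ]
    have hP : ∏ i ∈ Finset.range n, α i ≠ 0 := Finset.prod_ne_zero_iff.2 fun i _ => hα i
    generalize ∏ i ∈ Finset.range n, α i = P at hP
    have e1 : κ / (P * α n * α (n + 1)) * α (n + 1) = κ / (P * α n) := by
      field_simp [hα n, hα (n + 1)]
    have e2 : κ / (P * α n) * (α n * β n) = β n * (κ / P) := by
      field_simp [hα n]
    have e1' := congrArg (C : F → F[X]) e1
    have e2' := congrArg (C : F → F[X]) e2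
    simp only [C_mul] at e1' e2' ⊢
    linear_combination (-X * monicJacobi (fun i => α i * β i) (n + 1) +
      C (α n) * C (β n) * monicJacobi (fun i => α i * β i) n) * e1' +
      monicJacobi (fun i => α i * β i) n * e2'

/-! ### An obstruction to being classical. -/

/-- Degrees 1 and 2 express `τ` and `σ` through `ev 1` and `ev 2`. In degrees 3 and 4 the leading
coefficients give `ev 3` and `ev 4`, and the remaining ones give two homogeneous linear equations in
`ev 1` and `ev 2`. The hypotheses make that system nonsingular, so `σ = 0`. -/
theorem not_isClassicalSeq_monicJacobi {γ : ℕ → ℂ} (h0 : γ 0 ≠ 0) (h01 : γ 0 + γ 1 ≠ 0)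
    (hγ : (γ 0 + γ 1 + γ 2) * (γ 0 + γ 1) ≠ 6 * (γ 0 * γ 2)) :
    ¬ IsClassicalSeq (monicJacobi γ) := by
  rintro ⟨σ, τ, ev, hσ, -, -, h⟩
  have hτ (x : ℂ) : τ.eval x = ev 1 * x := by
    simpa [monicJacobi] using congrArg (eval x) (h 1)
  have hσ' (x : ℂ) : σ.eval x = (ev 2 / 2 - ev 1) * x ^ 2 - ev 2 / 2 * γ 0 := by
    have := congrArg (eval x) (h 2)
    simp [monicJacobi, hτ] at this
    linear_combination this / 2
  have h3 (x : ℂ) : ((ev 2 / 2 - ev 1) * x ^ 2 - ev 2 / 2 * γ 0) * (6 * x) +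
      ev 1 * x * (3 * x ^ 2 - (γ 0 + γ 1)) = ev 3 * (x ^ 3 - (γ 0 + γ 1) * x) := by
    have := congrArg (eval x) (h 3)
    simp [monicJacobi, hτ, hσ'] at this
    linear_combination this
  have h4 (x : ℂ) : ((ev 2 / 2 - ev 1) * x ^ 2 - ev 2 / 2 * γ 0) *
      (12 * x ^ 2 - 2 * (γ 0 + γ 1 + γ 2)) +
      ev 1 * x * (4 * x ^ 3 - 2 * (γ 0 + γ 1 + γ 2) * x) =
      ev 4 * (x ^ 4 - (γ 0 + γ 1 + γ 2) * x ^ 2 + γ 0 * γ 2) := by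
    have := congrArg (eval x) (h 4)
    simp [monicJacobi, hτ, hσ'] at this
    linear_combination this
  -- These combinations of values at 0, 1, 2 isolate the leading coefficients of an odd cubic and an
  -- even quartic.
  have e3 : ev 3 = 3 * ev 2 - 3 * ev 1 := by
    linear_combination h3 1 / 3 - h3 2 / 6
  have e4 : ev 4 = 6 * ev 2 - 8 * ev 1 := by
    linear_combination -(h4 2 - 4 * h4 1 + 3 * h4 0) / 12
  have c3 : ev 2 * γ 0 * 3 = (3 * ev 2 - 4 * ev 1) * (γ 0 + γ 1) := by
    linear_combination -h3 1 + (γ 0 + γ 1 - 1) * e3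
  have c4 : ev 2 * γ 0 * (γ 0 + γ 1 + γ 2) = 2 * (3 * ev 2 - 4 * ev 1) * (γ 0 * γ 2) := by
    linear_combination h4 0 + γ 0 * γ 2 * e4
  -- Eliminating `3 * ev 2 - 4 * ev 1` between `c3` and `c4` leaves `ev 2 * γ 0` times the
  -- difference of the two sides of `hγ`.
  have hev2 : ev 2 = 0 := by
    by_contra h2
    refine hγ (mul_left_cancel₀ (mul_ne_zero h2 h0) ?_)
    linear_combination (γ 0 + γ 1) * c4 - 2 * (γ 0 * γ 2) * c3
  have hev1 : ev 1 = 0 := by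
    rw [hev2] at c3
    have : ev 1 * (γ 0 + γ 1) = 0 := by linear_combination c3 / 4
    exact (mul_eq_zero.1 this).resolve_right h01
  exact hσ (Polynomial.funext fun x => by simp [hσ', hev1, hev2])

theorem IsClassicalSeq.of_C_mul {p q : ℕ → ℂ[X]} {k : ℕ → ℂ} (hk : ∀ n, k n ≠ 0)
    (hq : ∀ n, q n = C (k n) * p n) (h : IsClassicalSeq q) : IsClassicalSeq p := by
  obtain ⟨σ, τ, ev, hσ, h2, h1, h⟩ := h
  refine ⟨σ, τ, ev, hσ, h2, h1, fun n => mul_left_cancel₀ (C_ne_zero.2 (hk n)) ?_⟩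
  have := h n
  rw [hq] at this
  simp only [derivative_C_mul] at this
  linear_combination this

theorem exists_isOrthogonalPolynomialSeq {q : ℕ → ℂ[X]} {γ k : ℕ → ℝ} {M : ℝ}
    (hγ : ∀ n, 0 < γ n) (hM : ∀ n, γ n ≤ M) (hk : ∀ n, k n ≠ 0)
    (hq : ∀ n, q n = C (k n : ℂ) * monicJacobi (fun i => (γ i : ℂ)) n) :
    ∃ μ : Measure ℝ, IsOrthogonalPolynomialSeq μ q := by
  obtain ⟨μ, hμ⟩ := exists_measure_orthogonal_monicJacobi γ hγ hM
  have hev (n : ℕ) (x : ℝ) : (q n).eval (x : ℂ) = ((k n * (monicJacobi γ n).eval x : ℝ) : ℂ) := by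
    have h1 : monicJacobi (fun i => (γ i : ℂ)) n = (monicJacobi γ n).map Complex.ofRealHom :=
      (monicJacobi_map Complex.ofRealHom γ n).symm
    have h2 := eval_map_apply (p := monicJacobi γ n) Complex.ofRealHom x
    rw [Complex.ofRealHom_eq_coe, Complex.ofRealHom_eq_coe] at h2
    rw [hq, h1, eval_mul, eval_C, h2, Complex.ofReal_mul]
  have hmul (i j : ℕ) (x : ℝ) : (q i).eval (x : ℂ) * star ((q j).eval (x : ℂ)) =
      ((k i * k j * ((monicJacobi γ i).eval x * (monicJacobi γ j).eval x) : ℝ) : ℂ) := by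
    rw [hev, hev, Complex.star_def, Complex.conj_ofReal]
    push_cast
    ring
  have hsq (i : ℕ) (x : ℝ) : ‖(q i).eval (x : ℂ)‖ ^ 2 =
      k i ^ 2 * ((monicJacobi γ i).eval x * (monicJacobi γ i).eval x) := by
    rw [hev, Complex.norm_real, Real.norm_eq_abs, sq_abs]
    ring
  refine ⟨μ, fun n => ?_, fun i j => ?_, fun i j hij => ?_, fun i => ?_⟩
  · rw [hq, degree_C_mul (by exact_mod_cast hk n), degree_monicJacobi]
  · simp only [hmul]
    exact ((hμ i j).1.const_mul _).ofReal
  · simp only [hmul]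
    rw [integral_complex_ofReal, integral_const_mul, (hμ i j).2, if_neg hij]
    simp
  · simp only [hsq]
    rw [integral_const_mul, (hμ i i).2, if_pos rfl]
    have := hk i
    have := Finset.prod_pos fun j (_ : j ∈ Finset.range i) => hγ j
    positivity

/-! ### The superelliptic recurrence and its ultraspherical form. -/

theorem superellipticAux_odd (m n : ℕ) : superellipticAux m (2 * n + 1) = 0 := by
  induction n using Nat.twoStepInduction with
  | zero => simp [superellipticAux]
  | one => simp [superellipticAux]
  | more n h0 h1 =>
    have e : 2 * (n + 2) + 1 = (2 * n + 1) + 4 := by ring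
    have e' : 2 * n + 1 + 2 = 2 * (n + 1) + 1 := by ring
    rw [e, superellipticAux, h0, e', h1]
    simp

theorem superellipticP_of_odd (m : ℕ) {k : ℤ} (hk : -4 ≤ k) (ho : Odd k) :
    superellipticP m k = 0 := by
  obtain ⟨r, rfl⟩ := ho
  have e : (2 * r + 1 + 4).toNat = 2 * (r + 2).toNat + 1 := by omega
  rw [superellipticP, e, superellipticAux_odd]

theorem superellipticP_two_mul_rec {m : ℕ} (hm : m ≠ 0) :
    SatisfiesUltrasphericalRec (-1 / (m : ℂ)) (1 / 2 + 2 / (m : ℂ))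
      (fun s : ℤ => superellipticP m (2 * s)) := by
  intro n hn
  have hm' : (m : ℂ) ≠ 0 := Nat.cast_ne_zero.2 hm
  -- The index `k = 2n + 2` makes `P_k`, `P_{k-2}`, `P_{k-4}` equal to `q_{n+1}`, `q_n`, `q_{n-1}`;
  -- the coefficients then agree up to the factor `2 * m`.
  have h := superellipticP_rec m (2 * n + 2) (by omega)
  have e1 : 2 * n + 2 - 2 = 2 * n := by ring
  have e2 : 2 * n + 2 - 4 = 2 * (n - 1) := by ring
  have e3 : 2 * n + 2 = 2 * (n + 1) := by ring
  rw [e1, e2, e3] at h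
  have c1 : 2 * ((n : ℂ) + -1 / m + (1 / 2 + 2 / m)) =
      (2 * m : ℂ)⁻¹ * (2 * ((((2 * (n + 1) : ℤ) : ℂ) - 1) * m + 2)) := by
    push_cast
    field_simp
    ring
  have c2 : (n : ℂ) + (1 / 2 + 2 / m) + 1 =
      (2 * m : ℂ)⁻¹ * (((2 * (n + 1) : ℤ) : ℂ) * m + m + 4) := by
    push_cast
    field_simp
    ring
  have c3 : 2 * (-1 / (m : ℂ)) + n + (1 / 2 + 2 / m) - 1 =
      (2 * m : ℂ)⁻¹ * ((((2 * (n + 1) : ℤ) : ℂ) - 3) * m) := by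
    push_cast
    field_simp
    ring
  rw [c1, c2, c3, C_mul, C_mul (b := _ + (4 : ℂ)), C_mul (b := _ * (m : ℂ))]
  linear_combination -C (2 * m : ℂ)⁻¹ * h

/-- The initial value `P_{-4,-4} = 1` enters the even-index sequence from `q_{-1}` on only here,
through the recurrence at `k = 0`. -/
theorem superellipticP_zero (m : ℕ) :
    superellipticP m 0 = C (3 * (m : ℂ) / ((m : ℂ) + 4)) := by
  simp [superellipticP, superellipticAux, div_eq_inv_mul]

theorem SatisfiesUltrasphericalRec.eq_C_mul {ν c κ : ℂ} (hc : ∀ n : ℕ, (n : ℂ) + c + 1 ≠ 0)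
    {p q : ℤ → ℂ[X]} (hp : SatisfiesUltrasphericalRec ν c p)
    (hq : SatisfiesUltrasphericalRec ν c q) (h1 : q (-1) = C κ * p (-1))
    (h0 : q 0 = C κ * p 0) {s : ℤ} (hs : -1 ≤ s) : q s = C κ * p s := by
  -- The shift by one starts the two-step induction at the indices `-1` and `0`.
  suffices h : ∀ n : ℕ, q (n - 1) = C κ * p (n - 1) by
    obtain ⟨n, hn⟩ := Int.eq_ofNat_of_zero_le (by omega : 0 ≤ s + 1)
    rw [eq_sub_of_add_eq hn]
    exact h n
  intro n
  induction n using Nat.twoStepInduction with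
  | zero => simpa using h1
  | one => simpa using h0
  | more n ih0 ih1 =>
    have a := hp n (by omega)
    have b := hq n (by omega)
    have e1 : (((n + 1 : ℕ) : ℤ) - 1) = n := by push_cast; ring
    have e2 : (((n + 2 : ℕ) : ℤ) - 1) = n + 1 := by push_cast; ring
    rw [e1] at ih1
    rw [e2]
    rw [ih0, ih1] at b
    refine mul_left_cancel₀ (C_ne_zero.2 (hc n)) ?_
    simp only [Int.cast_natCast] at a b
    linear_combination C κ * a - b

/-! ### The monic recurrence coefficients and the conclusion. -/

/-- The recurrence coefficients of the monic multiples of `P_{-4,2s}`, where `w = 2 / m`. -/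
noncomputable def superellipticGamma (w : ℝ) (n : ℕ) : ℝ :=
  (2 * n + 3 + 2 * w) / (2 * (2 * n + 1 + w)) * ((2 * n + 1) / (2 * (2 * n + 3 + w)))

theorem superellipticGamma_pos {w : ℝ} (hw : 0 ≤ w) (n : ℕ) : 0 < superellipticGamma w n := by
  unfold superellipticGamma
  positivity

theorem superellipticGamma_le_one {w : ℝ} (hw : 0 ≤ w) (n : ℕ) : superellipticGamma w n ≤ 1 := by
  unfold superellipticGamma
  rw [div_mul_div_comm, div_le_one (by positivity)]
  have : (0 : ℝ) ≤ n := n.cast_nonneg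
  nlinarith [mul_nonneg this hw, mul_nonneg this this, mul_nonneg hw hw]

/-- At `w = 0` all coefficients are `1/4` (Chebyshev polynomials of the second kind, which are
classical) and the two sides agree; hence the difference carries a factor `w`, and its cofactor is
positive. -/
theorem superellipticGamma_lt {w : ℝ} (hw : 0 < w) :
    6 * (superellipticGamma w 0 * superellipticGamma w 2) <
      (superellipticGamma w 0 + superellipticGamma w 1 + superellipticGamma w 2) *
        (superellipticGamma w 0 + superellipticGamma w 1) := by
  have h01 : superellipticGamma w 0 + superellipticGamma w 1 =
      (5 + 4 * w) / (2 * (1 + w) * (5 + w)) := by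
    simp only [superellipticGamma]
    push_cast
    field_simp
    ring
  have h012 : superellipticGamma w 0 + superellipticGamma w 1 + superellipticGamma w 2 =
      3 * (7 + 6 * w) / (4 * (1 + w) * (7 + w)) := by
    rw [h01]
    simp only [superellipticGamma]
    push_cast
    field_simp
    ring
  rw [h012, h01, ← sub_pos]
  have : 3 * (7 + 6 * w) / (4 * (1 + w) * (7 + w)) * ((5 + 4 * w) / (2 * (1 + w) * (5 + w))) -
      6 * (superellipticGamma w 0 * superellipticGamma w 2) =
      3 * w * (4 + 10 * w + 4 * w ^ 2) /
        (8 * (1 + w) ^ 2 * (3 + w) * (5 + w) * (7 + w)) := by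
    simp only [superellipticGamma]
    push_cast
    field_simp
    ring
  rw [this]
  positivity

theorem superellipticP_two_mul_eq {m : ℕ} (hm : m ≠ 0) :
    ∃ k : ℕ → ℝ, (∀ n, k n ≠ 0) ∧ ∀ n : ℕ, superellipticP m (2 * (n : ℤ)) =
      C (k n : ℂ) * monicJacobi (fun i => (superellipticGamma (2 / m) i : ℂ)) n := by
  have hm' : (0 : ℝ) < m := Nat.cast_pos.2 (Nat.pos_of_ne_zero hm)
  have hmC : (m : ℂ) ≠ 0 := Nat.cast_ne_zero.2 hm
  set w : ℝ := 2 / m with hw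
  have hw0 : 0 < w := by positivity
  have hwC : (w : ℂ) = 2 / m := by rw [hw]; push_cast; rfl
  -- Division by `2 * (n + ν + c) = 2 * n + 1 + w` turns the ultraspherical recurrence into `x q_n =
  -- α_n q_{n+1} + β_{n-1} q_{n-1}`.
  let α : ℕ → ℝ := fun n => (2 * n + 3 + 2 * w) / (2 * (2 * n + 1 + w))
  let β : ℕ → ℝ := fun n => (2 * n + 1) / (2 * (2 * n + 3 + w))
  have hα (n : ℕ) : 0 < α n := by positivity
  have hd (n : ℕ) : (2 * n + 1 + w : ℂ) ≠ 0 := by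
    have : (2 * n + 1 + w : ℝ) ≠ 0 := by positivity
    exact_mod_cast this
  have hrec (n : ℕ) : C ((2 * n + 1 + w : ℂ)) * (X * superellipticP m (2 * (n : ℤ))) =
      C (2 * n + 1 + w : ℂ) * (C (α n : ℂ) * superellipticP m (2 * ((n + 1 : ℕ) : ℤ))) +
      C ((2 * n - 1) / 2 : ℂ) * superellipticP m (2 * ((n : ℤ) - 1)) := by
    have h := superellipticP_two_mul_rec hm n (by omega)
    have c1 : 2 * ((n : ℂ) + -1 / m + (1 / 2 + 2 / m)) = 2 * n + 1 + w := by
      rw [hwC]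
      ring
    have c2 : (n : ℂ) + (1 / 2 + 2 / m) + 1 = (2 * n + 1 + w) * (α n : ℂ) := by
      have e : (α n : ℂ) = (2 * n + 3 + 2 * w) / (2 * (2 * n + 1 + w)) := by simp [α]
      rw [e, mul_div_assoc', eq_div_iff (mul_ne_zero two_ne_zero (hd n)), hwC]
      ring
    have c3 : 2 * (-1 / (m : ℂ)) + n + (1 / 2 + 2 / m) - 1 = (2 * n - 1) / 2 := by
      ring
    simp only [Int.cast_natCast] at h
    rw [c1, c2, c3, C_mul] at h
    push_cast
    linear_combination h
  refine ⟨fun n => 3 * m / (m + 4) / ∏ i ∈ Finset.range n, α i, fun n => ?_, fun n => ?_⟩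
  · have := Finset.prod_pos fun i (_ : i ∈ Finset.range n) => hα i
    positivity
  have key := eq_C_mul_monicJacobi (α := fun n => (α n : ℂ)) (β := fun n => (β n : ℂ))
    (q := fun n : ℕ => superellipticP m (2 * (n : ℤ))) (κ := 3 * (m : ℂ) / ((m : ℂ) + 4))
    (fun n => by exact_mod_cast (hα n).ne') (superellipticP_zero m) ?_ (fun n => ?_) n
  · refine key.trans ?_
    push_cast [superellipticGamma]
    simp only [α, β]
    push_cast
    rfl
  · have h := hrec 0
    refine mul_left_cancel₀ (C_ne_zero.2 (hd 0)) (h.trans ?_)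
    -- At `n = 0` the last coefficient is `-1/2`, the only negative one; it disappears because
    -- `q_{-1} = 0`.
    have e : superellipticP m (2 * (((0 : ℕ) : ℤ) - 1)) = 0 := (superellipticP_init m).2.2.1
    rw [e]
    simp
  · have h := hrec (n + 1)
    refine mul_left_cancel₀ (C_ne_zero.2 (hd (n + 1))) (h.trans ?_)
    have e : (((n + 1 : ℕ) : ℤ) - 1) = n := by push_cast; ring
    have c : (2 * ((n + 1 : ℕ) : ℂ) - 1) / 2 = (2 * ((n + 1 : ℕ) : ℂ) + 1 + w) * (β n : ℂ) := by
      have := hd (n + 1)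
      have h3 : (2 * n + 3 + w : ℂ) ≠ 0 := by
        intro h3
        apply this
        push_cast
        linear_combination h3
      simp only [β]
      push_cast
      field_simp
      ring
    rw [e, c, C_mul]
    ring

theorem mainTheorem6 (m : ℕ) (hm : 2 ≤ m) :
    (∀ k : ℤ, -4 ≤ k → Odd k → superellipticP m k = 0) ∧
    SatisfiesUltrasphericalRec (-1 / (m : ℂ)) (1 / 2 + 2 / (m : ℂ))
      (fun s : ℤ => superellipticP m (2 * s)) ∧
    (∀ s : ℤ, -1 ≤ s →
      superellipticP m (2 * s) =
        C (3 * (m : ℂ) / ((m : ℂ) + 4)) *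
          assocUltraspherical (-1 / (m : ℂ)) (1 / 2 + 2 / (m : ℂ)) s) ∧
    (∃ μ : Measure ℝ,
      IsOrthogonalPolynomialSeq μ (fun s : ℕ => superellipticP m (2 * (s : ℤ)))) ∧
    ¬ IsClassicalSeq (fun s : ℕ => superellipticP m (2 * (s : ℤ))) := by
  have hm0 : m ≠ 0 := by omega
  have hw : (0 : ℝ) < 2 / m := by positivity
  obtain ⟨k, hk, hq⟩ := superellipticP_two_mul_eq hm0
  have hpos := superellipticGamma_pos hw.le
  refine ⟨fun _ => superellipticP_of_odd m, superellipticP_two_mul_rec hm0, fun s hs => ?_,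
    exists_isOrthogonalPolynomialSeq hpos (superellipticGamma_le_one hw.le) hk hq, fun h => ?_⟩
  · have hc (n : ℕ) : (n : ℂ) + (1 / 2 + 2 / (m : ℂ)) + 1 ≠ 0 := by
      have h : (((n : ℝ) + (1 / 2 + 2 / (m : ℝ)) + 1 : ℝ) : ℂ) ≠ 0 :=
        Complex.ofReal_ne_zero.2 (by positivity)
      push_cast at h
      exact h
    refine SatisfiesUltrasphericalRec.eq_C_mul hc (assocUltraspherical_rec _ _ hc)
      (superellipticP_two_mul_rec hm0) ?_ ?_ hs
    · rw [(assocUltraspherical_init _ _).1, mul_zero]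
      exact (superellipticP_init m).2.2.1
    · rw [(assocUltraspherical_init _ _).2, mul_one]
      exact superellipticP_zero m
  · refine not_isClassicalSeq_monicJacobi ?_ ?_ ?_
      (h.of_C_mul (fun n => Complex.ofReal_ne_zero.2 (hk n)) hq)
    · exact_mod_cast (hpos 0).ne'
    · exact_mod_cast (add_pos (hpos 0) (hpos 1)).ne'
    · exact_mod_cast (superellipticGamma_lt hw).ne'
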